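/- Let $n\ge 2$ and $1\le k\le n$. Passengers $1,\dots,n$ board, in this order, a plane with $n$ seats, each passenger having a dedicated seat of their own. Each of the first $k$ (absent-minded) passengers takes a seat uniformly at random among the seats that are still free; each of the remaining $n-k$ passengers takes the dedicated seat if it is still free, and otherwise a seat uniformly at random among the free ones. Let $X_n$ be the number of passengers sitting in a wrong seat, $p_{n,k,r}=P(X_n=r)$, and $f_n^{(k)}(w)=\sum_{r=0}^n p_{n,k,r}w^r$. Put $M_l(n,k)=\big(w\tfrac{d}{dw}\big)^l f_n^{(k)}(w)\big|_{w=1}$ for $l\ge 0$ (so $M_0(n,k)=1$ and $M_1(n,k)=E(X_n)$), and let $$m_l(n,k)=\sum_{i=0}^l\binom{l}{i}(-1)^{l-i}M_i(n,k)\,M_1(n,k)^{l-i}$$ be the $l$-th central moment of $X_n$. Then for every fixed $k\ge 1$ the limit $$c_l(k)=\lim_{n\to\infty}\frac{m_l(n,k)}{m_2(n,k)^{l/2}}$$ exists for every $1\le l\le 18$, with $c_l(k)=0$ for odd $l\le 17$, and $$c_{2j}(k)=(2j-1)!!=\prod_{i=1}^{j}(2i-1)\qquad(1\le j\le 9),$$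 that is, $c_2(k),c_4(k),\dots,c_{18}(k)$ are $1,3,15,105,945,10395,135135,2027025,34459425$. Thus for $1\le l\le 18$ the limit $c_l(k)$ equals the $l$-th moment $E(Z^l)$ of a standard normal random variable $Z$. -/

import Mathlib

/-!
Seats and passengers are both labelled by `Fin n`, in boarding order, so that the dedicated seat
of passenger `i` is seat `i`. Passengers `0, …, k - 1` are the absent-minded ones.
-/

namespace AbsentMinded

open Polynomial

noncomputable section

/-- The law of the seat chosen by passenger `i` when the set of free seats is `F`: a passenger who
is not absent-minded takes the dedicated seat if it is free; otherwise (and for an absent-minded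
passenger always) the seat is uniform on `F`. In the boarding process `F` is never empty; the last
branch only makes the function total. -/
def seatChoice (n k : ℕ) (i : Fin n) (F : Finset (Fin n)) : PMF (Fin n) :=
  if k ≤ (i : ℕ) ∧ i ∈ F then PMF.pure i
  else if h : F.Nonempty then PMF.uniformOfFinset F h
  else PMF.pure i

/-- The passengers in the list enter one after another while the set of free seats is `F`. The
result is the law of the seating, which sends each passenger of the list to the seat taken
(other passengers are sent to themselves). -/
def board (n k : ℕ) : List (Fin n) → Finset (Fin n) → PMF (Fin n → Fin n)
  | [], _ => PMF.pure id
  | i :: rest, F =>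
      (seatChoice n k i F).bind fun s =>
        (board n k rest (F.erase s)).map fun σ => Function.update σ i s

/-- The law of the final seating: all `n` passengers board in order, all seats being free at the
start. -/
def seatingLaw (n k : ℕ) : PMF (Fin n → Fin n) :=
  board n k (List.finRange n) Finset.univ

/-- The random variable `X_n`: the number of passengers sitting in the wrong seat. -/
def wrongSeats {n : ℕ} (σ : Fin n → Fin n) : ℕ :=
  (Finset.univ.filter fun i => σ i ≠ i).card

/-- `p_{n,k,r}`: the probability that exactly `r` passengers sit in the wrong seat. -/
def prob (n k r : ℕ) : ℝ :=
  ((seatingLaw n k).map wrongSeats r).toReal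

/-- The probability generating function `f_n^{(k)}(w) = ∑_{r=0}^n p_{n,k,r} w^r`. -/
def genFun (n k : ℕ) : ℝ[X] :=
  ∑ r ∈ Finset.range (n + 1), C (prob n k r) * X ^ r

/-- `M_l(n,k) = (w d/dw)^l f_n^{(k)}(w)` at `w = 1` (for `l = 0` this is `f_n^{(k)}(1) = 1`). -/
def rawMoment (l n k : ℕ) : ℝ :=
  (((fun q : ℝ[X] => X * derivative q)^[l]) (genFun n k)).eval 1

/-- The `l`-th moment `m_l(n,k)` of `X_n` about its mean `M_1(n,k)`. -/
def centralMoment (l n k : ℕ) : ℝ :=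
  ∑ i ∈ Finset.range (l + 1),
    (l.choose i : ℝ) * (-1) ^ (l - i) * rawMoment i n k * rawMoment 1 n k ^ (l - i)

end

end AbsentMinded

/-! The number of wrongly seated passengers among the last $n-k$ is distributed exactly as a sum of
independent Bernoulli variables with parameters $k/(m+k)$, $1\le m\le n-k$. When passenger $i\ge k$
enters with $N=n-i$ seats free, the free set is a uniform $N$-subset of the $N+k$ seats that can
still be free, whatever happened before, so the dedicated seat is gone with probability $k/(N+k)$.
This is `sum_lateExpect`, extended over the absent-minded passengers to
`expect_seatingLaw_lateWrong`. The absent-minded passengers change $X_n$ by at most $k$.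

The method of moments then applies. Adding one variable of variance $v$ raises the central moment
$\mu_{l+2}$ by $\binom{l+2}{2}v\mu_l$ plus lower-order terms. With $U$ equal to one plus the
variance, summation gives $\mu_l=O(U^{\lfloor l/2\rfloor})$ and $\mu_{2j}=(2j-1)!!\,U^j+O(U^{j-1})$:
`exists_abs_bernoulliMoment_le` and `exists_abs_bernoulliMoment_even_sub_le`. A perturbation bounded
by $k$ costs only $O(U^{(l-1)/2})$, and $U\to\infty$ by comparison with the harmonic series, so the
normalized moments converge for every $l\ge 1$. -/

namespace AbsentMinded

open Finset

/-- The expectation of a real function on a finite type. -/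
noncomputable def expect {α : Type*} [Fintype α] (p : PMF α) (f : α → ℝ) : ℝ :=
  ∑ a, (p a).toReal * f a

/-! ### Expectations over finite probability spaces -/

section Expect

variable {α β : Type*} [Fintype α] [Fintype β]

lemma expect_pure (a : α) (f : α → ℝ) : expect (PMF.pure a) f = f a := by
  classical
  unfold expect
  rw [Finset.sum_eq_single a]
  · simp
  · intro b _ hb
    simp [PMF.pure_apply, hb]
  · simp

lemma expect_bind (p : PMF α) (q : α → PMF β) (f : β → ℝ) :
    expect (p.bind q) f = expect p fun a => expect (q a) f := by
  unfold expect
  have h : ∀ b, ((p.bind q) b).toReal = ∑ a, (p a).toReal * (q a b).toReal := by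
    intro b
    rw [PMF.bind_apply, tsum_fintype, ENNReal.toReal_sum]
    · simp [ENNReal.toReal_mul]
    · intro a _
      exact ENNReal.mul_ne_top (p.apply_ne_top a) ((q a).apply_ne_top b)
  simp_rw [h, Finset.sum_mul, Finset.mul_sum]
  rw [Finset.sum_comm]
  simp_rw [mul_assoc]

lemma expect_map (p : PMF α) (g : α → β) (f : β → ℝ) :
    expect (p.map g) f = expect p fun a => f (g a) := by
  rw [PMF.map, expect_bind]
  simp [expect_pure]

lemma expect_uniformOfFinset (F : Finset α) (h : F.Nonempty) (f : α → ℝ) :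
    expect (PMF.uniformOfFinset F h) f = (∑ s ∈ F, f s) / #F := by
  classical
  unfold expect
  rw [Finset.sum_div, ← Finset.sum_subset (Finset.subset_univ F)]
  · refine Finset.sum_congr rfl fun s hs => ?_
    rw [PMF.uniformOfFinset_apply_of_mem h hs]
    simp [div_eq_inv_mul]
  · intro s _ hs
    rw [PMF.uniformOfFinset_apply_of_notMem h hs]
    simp

lemma expect_const (p : PMF α) (c : ℝ) : expect p (fun _ => c) = c := by
  unfold expect
  rw [← Finset.sum_mul, ← ENNReal.toReal_sum fun a _ => p.apply_ne_top a,
    ← tsum_fintype (L := .unconditional α), p.tsum_coe]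
  simp

lemma expect_add (p : PMF α) (f g : α → ℝ) :
    expect p (fun a => f a + g a) = expect p f + expect p g := by
  simp [expect, mul_add, Finset.sum_add_distrib]

lemma expect_sub (p : PMF α) (f g : α → ℝ) :
    expect p (fun a => f a - g a) = expect p f - expect p g := by
  simp [expect, mul_sub, Finset.sum_sub_distrib]

lemma expect_const_mul (p : PMF α) (c : ℝ) (f : α → ℝ) :
    expect p (fun a => c * f a) = c * expect p f := by
  simp [expect, Finset.mul_sum, mul_left_comm]

lemma expect_sum {ι : Type*} (p : PMF α) (t : Finset ι) (f : ι → α → ℝ) :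
    expect p (fun a => ∑ i ∈ t, f i a) = ∑ i ∈ t, expect p (f i) := by
  simp only [expect, Finset.mul_sum]
  exact Finset.sum_comm

lemma expect_mono (p : PMF α) {f g : α → ℝ} (h : ∀ a, f a ≤ g a) : expect p f ≤ expect p g :=
  Finset.sum_le_sum fun a _ => mul_le_mul_of_nonneg_left (h a) ENNReal.toReal_nonneg

lemma abs_expect_le (p : PMF α) (f : α → ℝ) : |expect p f| ≤ expect p fun a => |f a| := by
  refine (Finset.abs_sum_le_sum_abs _ _).trans (Finset.sum_le_sum fun a _ => ?_)
  rw [abs_mul, abs_of_nonneg ENNReal.toReal_nonneg]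

end Expect

lemma toReal_map_apply {α γ : Type*} [Fintype α] [DecidableEq γ] (p : PMF α) (g : α → γ)
    (c : γ) : ((p.map g) c).toReal = expect p fun a => if g a = c then 1 else 0 := by
  classical
  rw [PMF.map_apply, tsum_fintype, ENNReal.toReal_sum]
  · refine Finset.sum_congr rfl fun a _ => ?_
    by_cases h : g a = c
    · simp [h]
    · simp [h, Ne.symm h]
  · intro a _
    split_ifs
    · exact p.apply_ne_top a
    · simp

/-- Double counting: a pair ($F$, $s\in F$) corresponds to the pair ($F\setminus\{s\}$, $s$), and an
$m$-subset of $R$ arises from one choice of $s$ for each element of $R$ outside it.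
Probabilistically, removing a uniform element of a uniform subset leaves a uniform subset. -/
lemma sum_powersetCard_succ_sum_erase {α : Type*} [DecidableEq α] (R : Finset α) (m : ℕ)
    (h : Finset α → ℝ) :
    ∑ F ∈ R.powersetCard (m + 1), ∑ s ∈ F, h (F.erase s) =
      ((#R : ℝ) - m) * ∑ F ∈ R.powersetCard m, h F := by
  have h1 : ∑ F ∈ R.powersetCard (m + 1), ∑ s ∈ F, h (F.erase s) =
      ∑ F ∈ R.powersetCard m, ∑ _s ∈ R \ F, h F := by
    rw [Finset.sum_sigma', Finset.sum_sigma']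
    refine Finset.sum_bij' (fun x _ => ⟨x.1.erase x.2, x.2⟩) (fun x _ => ⟨insert x.2 x.1, x.2⟩)
      ?_ ?_ ?_ ?_ ?_
    · rintro ⟨F, s⟩ hx
      simp only [mem_sigma, mem_powersetCard, mem_sdiff] at hx ⊢
      obtain ⟨⟨hF, hc⟩, hs⟩ := hx
      refine ⟨⟨(erase_subset _ _).trans hF, ?_⟩, hF hs, by simp⟩
      rw [card_erase_of_mem hs, hc, Nat.add_sub_cancel]
    · rintro ⟨F, s⟩ hx
      simp only [mem_sigma, mem_powersetCard, mem_sdiff] at hx ⊢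
      obtain ⟨⟨hF, hc⟩, hs, hsF⟩ := hx
      exact ⟨⟨insert_subset hs hF, by rw [card_insert_of_notMem hsF, hc]⟩, by simp⟩
    · rintro ⟨F, s⟩ hx
      simp only [mem_sigma] at hx
      simp [insert_erase hx.2]
    · rintro ⟨F, s⟩ hx
      simp only [mem_sigma, mem_sdiff] at hx
      simp [erase_insert hx.2.2]
    · rintro ⟨F, s⟩ hx
      rfl
  rw [h1, Finset.mul_sum]
  refine Finset.sum_congr rfl fun F hF => ?_
  rw [mem_powersetCard] at hF
  rw [Finset.sum_const, nsmul_eq_mul, card_sdiff_of_subset hF.1, Nat.cast_sub (card_le_card hF.1),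
    hF.2]

/-- Expectation with respect to the law of a sum of `N` independent Bernoulli variables with
success probabilities `k / (m + k)`, `1 ≤ m ≤ N`. -/
noncomputable def bernoulliSum (k : ℕ) : ℕ → (ℕ → ℝ) →ₗ[ℝ] ℝ
  | 0 => LinearMap.proj 0
  | N + 1 =>
      (((N : ℝ) + 1) / (N + 1 + k)) • bernoulliSum k N +
        ((k : ℝ) / (N + 1 + k)) • (bernoulliSum k N).comp (LinearMap.funLeft ℝ ℝ Nat.succ)

lemma bernoulliSum_succ (k N : ℕ) (g : ℕ → ℝ) :
    bernoulliSum k (N + 1) g = ((N : ℝ) + 1) / (N + 1 + k) * bernoulliSum k N g +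
      (k : ℝ) / (N + 1 + k) * bernoulliSum k N (fun x => g (x + 1)) := rfl

/-! ### The exact law of the late passengers in wrong seats -/

section Boarding

variable {n : ℕ}

/-- The number of passengers of the list who are not absent-minded and sit in a wrong seat. -/
def lateWrong (k : ℕ) (l : List (Fin n)) (σ : Fin n → Fin n) : ℕ :=
  l.countP fun i : Fin n => k ≤ (i : ℕ) ∧ σ i ≠ i

lemma lateWrong_cons_update (k : ℕ) (i s : Fin n) (l : List (Fin n)) (hi : i ∉ l)
    (σ : Fin n → Fin n) :
    lateWrong k (i :: l) (Function.update σ i s) =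
      lateWrong k l σ + if k ≤ (i : ℕ) ∧ s ≠ i then 1 else 0 := by
  unfold lateWrong
  rw [List.countP_cons]
  congr 1
  · refine List.countP_congr fun j hj => ?_
    have : j ≠ i := fun h => hi (h ▸ hj)
    simp [Function.update_of_ne this]
  · simp

/-- The expectation of a function of `lateWrong` when the passengers of the list board and `F` is
the set of free seats. -/
noncomputable def lateExpect (k : ℕ) (l : List (Fin n)) (F : Finset (Fin n)) (g : ℕ → ℝ) : ℝ :=
  expect (board n k l F) fun σ => g (lateWrong k l σ)

lemma lateExpect_nil (k : ℕ) (F : Finset (Fin n)) (g : ℕ → ℝ) : lateExpect k [] F g = g 0 := by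
  simp [lateExpect, board, expect_pure, lateWrong]

lemma lateExpect_cons (k : ℕ) (i : Fin n) (l : List (Fin n)) (hi : i ∉ l) (F : Finset (Fin n))
    (g : ℕ → ℝ) :
    lateExpect k (i :: l) F g = expect (seatChoice n k i F) fun s =>
      lateExpect k l (F.erase s) fun x => g (x + if k ≤ (i : ℕ) ∧ s ≠ i then 1 else 0) := by
  simp only [lateExpect, board, expect_bind, expect_map, lateWrong_cons_update k i _ l hi]

lemma lateExpect_cons_of_mem (k : ℕ) (i : Fin n) (l : List (Fin n)) (hi : i ∉ l)
    (F : Finset (Fin n)) (g : ℕ → ℝ) (hk : k ≤ (i : ℕ)) (hF : i ∈ F) :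
    lateExpect k (i :: l) F g = lateExpect k l (F.erase i) g := by
  rw [lateExpect_cons k i l hi, seatChoice, if_pos ⟨hk, hF⟩, expect_pure]
  simp

lemma lateExpect_cons_of_notMem (k : ℕ) (i : Fin n) (l : List (Fin n)) (hi : i ∉ l)
    (F : Finset (Fin n)) (g : ℕ → ℝ) (hk : k ≤ (i : ℕ)) (hF : i ∉ F) (hne : F.Nonempty) :
    lateExpect k (i :: l) F g =
      (∑ s ∈ F, lateExpect k l (F.erase s) fun x => g (x + 1)) / #F := by
  rw [lateExpect_cons k i l hi, seatChoice, if_neg (fun h => hF h.2), dif_pos hne,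
    expect_uniformOfFinset]
  congr 1
  refine Finset.sum_congr rfl fun s hs => ?_
  have : s ≠ i := fun h => hF (h ▸ hs)
  simp [hk, this]

lemma lateExpect_cons_of_lt (k : ℕ) (i : Fin n) (l : List (Fin n)) (hi : i ∉ l)
    (F : Finset (Fin n)) (g : ℕ → ℝ) (hk : (i : ℕ) < k) (hne : F.Nonempty) :
    lateExpect k (i :: l) F g = (∑ s ∈ F, lateExpect k l (F.erase s) g) / #F := by
  rw [lateExpect_cons k i l hi, seatChoice, if_neg (fun h => absurd h.1 (not_le.2 hk)),
    dif_pos hne, expect_uniformOfFinset]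
  simp [not_le.2 hk]

/-- The seats that can be free when passenger `i` enters. -/
def openSeats (n k i : ℕ) : Finset (Fin n) :=
  univ.filter fun x => (x : ℕ) < k ∨ i ≤ (x : ℕ)

lemma openSeats_eq_insert (k i : ℕ) (h : i < n) :
    openSeats n k i = insert ⟨i, h⟩ (openSeats n k (i + 1)) := by
  ext x
  simp only [openSeats, mem_filter, mem_univ, true_and, mem_insert, Fin.ext_iff]
  omega

lemma notMem_openSeats_succ (k i : ℕ) (h : i < n) (hk : k ≤ i) :
    (⟨i, h⟩ : Fin n) ∉ openSeats n k (i + 1) := by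
  simp [openSeats, hk]

lemma card_openSeats (k : ℕ) (N : ℕ) : ∀ i, i + N = n → k ≤ i → #(openSeats n k i) = N + k := by
  induction N with
  | zero =>
    intro i hi hk
    have : openSeats n k i = univ.filter fun x : Fin n => (x : ℕ) < k := by
      ext x
      have := x.2
      simp only [openSeats, mem_filter, mem_univ, true_and]
      omega
    rw [this, Fin.card_filter_val_lt]
    omega
  | succ N ih =>
    intro i hi hk
    have h : i < n := by omega
    rw [openSeats_eq_insert k i h, card_insert_of_notMem (notMem_openSeats_succ k i h hk),
      ih (i + 1) (by omega) (by omega)]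
    omega

lemma drop_finRange (i : ℕ) (h : i < n) :
    (List.finRange n).drop i = ⟨i, h⟩ :: (List.finRange n).drop (i + 1) := by
  rw [List.drop_eq_getElem_cons (by simpa using h)]
  simp

lemma notMem_drop_finRange (i : ℕ) (h : i < n) :
    (⟨i, h⟩ : Fin n) ∉ (List.finRange n).drop (i + 1) := by
  have h1 : ((List.finRange n).drop i).Nodup :=
    (List.nodup_finRange n).sublist (List.drop_sublist _ _)
  rw [drop_finRange i h] at h1
  exact (List.nodup_cons.1 h1).1

/-- Divided by the binomial coefficient, the left side averages over a uniform free set. Splitting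
by whether seat $i$ is free gives the two terms of the recursion for `bernoulliSum`; in both cases
the next free set is again uniform. -/
lemma sum_lateExpect (k N : ℕ) : ∀ (i : ℕ) (g : ℕ → ℝ), i + N = n → k ≤ i →
    ∑ F ∈ (openSeats n k i).powersetCard N, lateExpect k ((List.finRange n).drop i) F g =
      ((N + k).choose k : ℝ) * bernoulliSum k N g := by
  induction N with
  | zero =>
    intro i g hi hk
    have : (List.finRange n).drop i = [] := List.drop_eq_nil_of_le (by simp; omega)
    simp [this, lateExpect_nil, bernoulliSum]
  | succ N ih =>
    intro i g hi hk
    have h : i < n := by omega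
    have hnot := notMem_openSeats_succ k i h hk
    have hl := notMem_drop_finRange i h
    rw [openSeats_eq_insert k i h, powersetCard_succ_insert hnot, sum_union, sum_image]
    · rw [drop_finRange i h]
      have e1 : ∀ F ∈ (openSeats n k (i + 1)).powersetCard (N + 1),
          lateExpect k (⟨i, h⟩ :: (List.finRange n).drop (i + 1)) F g =
            (∑ s ∈ F, lateExpect k ((List.finRange n).drop (i + 1)) (F.erase s)
              fun x => g (x + 1)) / (N + 1 : ℕ) := by
        intro F hF
        rw [mem_powersetCard] at hF
        rw [lateExpect_cons_of_notMem k _ _ hl F g hk (fun hm => hnot (hF.1 hm))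
          (card_pos.1 (by omega)), hF.2]
      have e2 : ∀ F ∈ (openSeats n k (i + 1)).powersetCard N,
          lateExpect k (⟨i, h⟩ :: (List.finRange n).drop (i + 1)) (insert ⟨i, h⟩ F) g =
            lateExpect k ((List.finRange n).drop (i + 1)) F g := by
        intro F hF
        rw [mem_powersetCard] at hF
        rw [lateExpect_cons_of_mem k _ _ hl _ g hk (mem_insert_self _ _),
          erase_insert fun hm => hnot (hF.1 hm)]
      rw [sum_congr rfl e1, sum_congr rfl e2, ← Finset.sum_div,
        sum_powersetCard_succ_sum_erase _ _
          (fun F => lateExpect k ((List.finRange n).drop (i + 1)) F fun x => g (x + 1)),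
        ih (i + 1) g (by omega) (by omega), ih (i + 1) _ (by omega) (by omega),
        card_openSeats k N (i + 1) (by omega) (by omega), bernoulliSum_succ]
      -- The ratio of the two binomial coefficients supplies the Bernoulli probabilities.
      have hc : ((N + 1 + k).choose k : ℝ) * (N + 1) = (N + k).choose k * (N + 1 + k) := by
        have := Nat.add_one_mul_choose_eq (N + k) N
        rw [Nat.choose_symm_add, add_right_comm, Nat.choose_symm_add] at this
        exact_mod_cast this.symm.trans (mul_comm _ _)
      have hN : (N : ℝ) + 1 ≠ 0 := by positivity
      have hNk : (N : ℝ) + 1 + k ≠ 0 := by positivity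
      have hc' : ((N + 1 + k).choose k : ℝ) = (N + k).choose k * (N + 1 + k) / (N + 1) := by
        rw [← hc]; field_simp
      rw [hc']
      push_cast
      field_simp
      ring
    · intro F hF F' hF' he
      rw [mem_coe, mem_powersetCard] at hF hF'
      rw [← erase_insert fun hm => hnot (hF.1 hm), he, erase_insert fun hm => hnot (hF'.1 hm)]
    · rw [disjoint_left]
      intro F hF hF'
      rw [mem_powersetCard] at hF
      obtain ⟨F', -, rfl⟩ := mem_image.1 hF'
      exact hnot (hF.1 (mem_insert_self _ _))

/-- An absent-minded passenger removes a uniform seat and contributes nothing to `lateWrong`, so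
uniformity of the free set persists until passenger $k$. At $i=0$ the only subset is the full set of
seats. -/
lemma sum_lateExpect_of_le (k j : ℕ) (g : ℕ → ℝ) (hk : k ≤ n) : ∀ i, i + j = k →
    ∑ F ∈ (univ : Finset (Fin n)).powersetCard (n - i),
        lateExpect k ((List.finRange n).drop i) F g =
      (n.choose i : ℝ) * bernoulliSum k (n - k) g := by
  induction j with
  | zero =>
    intro i hi
    obtain rfl : i = k := by omega
    have := sum_lateExpect (n := n) i (n - i) i g (by omega) le_rfl
    rw [Nat.sub_add_cancel hk] at this
    rw [← this]
    have hu : openSeats n i i = univ := filter_true_of_mem fun x _ => lt_or_ge _ _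
    rw [hu]
  | succ j ih =>
    intro i hi
    have h : i < n := by omega
    have hl := notMem_drop_finRange i h
    have hcard : n - i = (n - (i + 1)) + 1 := by omega
    rw [drop_finRange i h, hcard]
    have e : ∀ F ∈ (univ : Finset (Fin n)).powersetCard (n - (i + 1) + 1),
        lateExpect k (⟨i, h⟩ :: (List.finRange n).drop (i + 1)) F g =
          (∑ s ∈ F, lateExpect k ((List.finRange n).drop (i + 1)) (F.erase s) g) /
            (n - (i + 1) + 1 : ℕ) := by
      intro F hF
      rw [mem_powersetCard] at hF
      rw [lateExpect_cons_of_lt k _ _ hl F g (by simp; omega) (card_pos.1 (by omega)), hF.2]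
    rw [sum_congr rfl e, ← Finset.sum_div, sum_powersetCard_succ_sum_erase _ _
      (fun F => lateExpect k ((List.finRange n).drop (i + 1)) F g), ih (i + 1) (by omega),
      card_univ, Fintype.card_fin, ← hcard]
    have hc : (n.choose (i + 1) : ℝ) * (i + 1) = n.choose i * ((n - i : ℕ) : ℝ) := by
      exact_mod_cast Nat.choose_succ_right_eq n i
    have hpos : ((n - i : ℕ) : ℝ) ≠ 0 := by
      have : n - i ≠ 0 := by omega
      exact_mod_cast this
    rw [Nat.cast_sub (show i + 1 ≤ n by omega), div_eq_iff hpos]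
    push_cast
    linear_combination (bernoulliSum k (n - k) g) * hc

lemma expect_seatingLaw_lateWrong (k : ℕ) (g : ℕ → ℝ) (hk : k ≤ n) :
    expect (seatingLaw n k) (fun σ => g (lateWrong k (List.finRange n) σ)) =
      bernoulliSum k (n - k) g := by
  have := sum_lateExpect_of_le k k g hk 0 (by omega)
  have hp : (univ : Finset (Fin n)).powersetCard n = {univ} := by
    simpa using powersetCard_self (univ : Finset (Fin n))
  simpa [hp, lateExpect, seatingLaw] using this

lemma lateWrong_le_wrongSeats (k : ℕ) (σ : Fin n → Fin n) :
    lateWrong k (List.finRange n) σ ≤ wrongSeats σ ∧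
      wrongSeats σ ≤ lateWrong k (List.finRange n) σ + k := by
  have h : lateWrong k (List.finRange n) σ = #(univ.filter fun i : Fin n => k ≤ (i : ℕ) ∧ σ i ≠ i) := by
    rw [lateWrong, List.countP_eq_length_filter, Finset.card_def]
    simp [Finset.filter, Finset.univ, Fintype.elems, Multiset.filter_coe]
  rw [h, wrongSeats]
  constructor
  · exact card_le_card fun x hx => by simp at hx ⊢; exact hx.2
  · calc _ ≤ #((univ.filter fun i : Fin n => k ≤ (i : ℕ) ∧ σ i ≠ i) ∪
          univ.filter fun i : Fin n => (i : ℕ) < k) := card_le_card fun x hx => by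
            simp at hx ⊢; simp [hx, le_or_gt]
      _ ≤ _ := card_union_le _ _
      _ ≤ _ := by
        rw [Fin.card_filter_val_lt]
        omega

lemma wrongSeats_le (σ : Fin n → Fin n) : wrongSeats σ ≤ n :=
  (card_le_univ _).trans (Fintype.card_fin n).le

end Boarding

/-! ### Moments of $X_n$ as expectations -/

section Moments

open Polynomial

/-- Each application of $w\,d/dw$ multiplies the coefficient of $w^r$ by $r$. -/
lemma iterate_eval_one (l n : ℕ) (a : ℕ → ℝ) :
    (((fun q : ℝ[X] => X * derivative q)^[l]) (∑ r ∈ range n, C (a r) * X ^ r)).eval 1 =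
      ∑ r ∈ range n, a r * (r : ℝ) ^ l := by
  induction l generalizing a with
  | zero => simp [eval_finsetSum]
  | succ l ih =>
    have : X * derivative (∑ r ∈ range n, C (a r) * X ^ r) =
        ∑ r ∈ range n, C (a r * r) * X ^ r := by
      rw [derivative_sum, Finset.mul_sum]
      refine sum_congr rfl fun r _ => ?_
      rw [derivative_C_mul_X_pow]
      rcases r with _ | r
      · simp
      · rw [Nat.add_sub_cancel, pow_succ]
        ring
    rw [Function.iterate_succ_apply, this, ih]
    exact sum_congr rfl fun r _ => by ring

lemma rawMoment_eq (l n k : ℕ) :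
    rawMoment l n k = expect (seatingLaw n k) fun σ => (wrongSeats σ : ℝ) ^ l := by
  rw [rawMoment, genFun, iterate_eval_one]
  simp_rw [prob, toReal_map_apply]
  have : ∀ σ : Fin n → Fin n, (wrongSeats σ : ℝ) ^ l =
      ∑ r ∈ range (n + 1), (r : ℝ) ^ l * if wrongSeats σ = r then 1 else 0 := by
    intro σ
    simp [Nat.lt_succ_of_le (wrongSeats_le σ)]
  simp_rw [this, expect_sum, expect_const_mul, mul_comm]

lemma centralMoment_eq (l n k : ℕ) :
    centralMoment l n k = expect (seatingLaw n k) fun σ =>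
      ((wrongSeats σ : ℝ) - expect (seatingLaw n k) fun τ => (wrongSeats τ : ℝ)) ^ l := by
  simp_rw [centralMoment, rawMoment_eq, pow_one]
  set m := expect (seatingLaw n k) fun τ => (wrongSeats τ : ℝ)
  have : ∀ σ : Fin n → Fin n, ((wrongSeats σ : ℝ) - m) ^ l =
      ∑ i ∈ range (l + 1), ((l.choose i : ℝ) * (-1) ^ (l - i) * m ^ (l - i)) *
        (wrongSeats σ : ℝ) ^ i := by
    intro σ
    rw [sub_eq_add_neg, add_pow]
    refine sum_congr rfl fun i _ => ?_
    rw [neg_pow]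
    ring
  simp_rw [this, expect_sum, expect_const_mul]
  exact sum_congr rfl fun i _ => by ring

end Moments

end AbsentMinded

namespace AbsentMinded

open Finset

/-! ### Central moments of the Bernoulli sum -/

section BernoulliSum

/-- The success probability of the `N`-th Bernoulli variable in `bernoulliSum`. -/
noncomputable def succProb (k N : ℕ) : ℝ := (k : ℝ) / (N + 1 + k)

/-- The mean of `bernoulliSum k N`. -/
noncomputable def bernoulliMean (k N : ℕ) : ℝ := ∑ m ∈ range N, succProb k m

/-- The variance of the `N`-th Bernoulli variable in `bernoulliSum`. -/
noncomputable def stepVar (k N : ℕ) : ℝ := succProb k N * (1 - succProb k N)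

/-- One plus the variance of `bernoulliSum k N`. -/
noncomputable def scaleSq (k N : ℕ) : ℝ := 1 + ∑ m ∈ range N, stepVar k m

/-- The `l`-th central moment of `bernoulliSum k N`. -/
noncomputable def bernoulliMoment (k l N : ℕ) : ℝ :=
  bernoulliSum k N fun x => ((x : ℝ) - bernoulliMean k N) ^ l

/-- The `j`-th central moment of the `N`-th Bernoulli variable in `bernoulliSum`. -/
noncomputable def stepMoment (k j N : ℕ) : ℝ :=
  (1 - succProb k N) * (-succProb k N) ^ j + succProb k N * (1 - succProb k N) ^ j

lemma one_sub_succProb (k N : ℕ) : 1 - succProb k N = ((N : ℝ) + 1) / (N + 1 + k) := by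
  have : (N : ℝ) + 1 + k ≠ 0 := by positivity
  rw [succProb]
  field_simp
  ring

lemma succProb_nonneg (k N : ℕ) : 0 ≤ succProb k N := by rw [succProb]; positivity

lemma one_sub_succProb_nonneg (k N : ℕ) : 0 ≤ 1 - succProb k N := by
  rw [one_sub_succProb]; positivity

lemma stepVar_nonneg (k N : ℕ) : 0 ≤ stepVar k N :=
  mul_nonneg (succProb_nonneg k N) (one_sub_succProb_nonneg k N)

lemma stepVar_le_one (k N : ℕ) : stepVar k N ≤ 1 := by
  have h1 := succProb_nonneg k N
  have h2 := one_sub_succProb_nonneg k N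
  rw [stepVar]
  nlinarith

lemma scaleSq_succ (k N : ℕ) : scaleSq k (N + 1) = scaleSq k N + stepVar k N := by
  rw [scaleSq, sum_range_succ, scaleSq, add_assoc]

lemma one_le_scaleSq (k N : ℕ) : 1 ≤ scaleSq k N :=
  le_add_of_nonneg_right (sum_nonneg fun m _ => stepVar_nonneg k m)

lemma stepMoment_zero (k N : ℕ) : stepMoment k 0 N = 1 := by simp [stepMoment]

lemma stepMoment_one (k N : ℕ) : stepMoment k 1 N = 0 := by simp [stepMoment]; ring

lemma stepMoment_two (k N : ℕ) : stepMoment k 2 N = stepVar k N := by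
  rw [stepMoment, stepVar]; ring

/-- With $p$ the success probability, $p(1-p)$ factors out and leaves at most
$p^{j+1}+(1-p)^{j+1}\le 1$. -/
lemma abs_stepMoment_le (k j N : ℕ) : |stepMoment k (j + 2) N| ≤ stepVar k N := by
  have hp := succProb_nonneg k N
  have hq := one_sub_succProb_nonneg k N
  rw [stepMoment, stepVar]
  set p := succProb k N
  have h1 : p ^ (j + 1) ≤ p := pow_le_of_le_one hp (by linarith) (by omega)
  have h2 : (1 - p) ^ (j + 1) ≤ 1 - p := pow_le_of_le_one hq (by linarith) (by omega)
  calc _ ≤ |(1 - p) * (-p) ^ (j + 2)| + |p * (1 - p) ^ (j + 2)| := abs_add_le _ _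
    _ = p * (1 - p) * (p ^ (j + 1) + (1 - p) ^ (j + 1)) := by
      rw [abs_mul, abs_mul, abs_pow, abs_pow, abs_neg, abs_of_nonneg hp, abs_of_nonneg hq]
      ring
    _ ≤ p * (1 - p) * 1 := mul_le_mul_of_nonneg_left (by linarith) (mul_nonneg hp hq)
    _ = _ := mul_one _

/-- Conditioning on the new variable shifts the centred sum by $-p$ or $1-p$; both powers are
expanded binomially. -/
lemma bernoulliMoment_succ (k l N : ℕ) :
    bernoulliMoment k l (N + 1) = ∑ j ∈ range (l + 1),
      (l.choose j : ℝ) * stepMoment k j N * bernoulliMoment k (l - j) N := by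
  have h : ∀ c : ℝ, bernoulliSum k N (fun x => ((x : ℝ) - bernoulliMean k N + c) ^ l) =
      ∑ j ∈ range (l + 1), ((l.choose j : ℝ) * c ^ j) * bernoulliMoment k (l - j) N := by
    intro c
    have : (fun x : ℕ => ((x : ℝ) - bernoulliMean k N + c) ^ l) =
        ∑ j ∈ range (l + 1), ((l.choose j : ℝ) * c ^ j) •
          fun x : ℕ => ((x : ℝ) - bernoulliMean k N) ^ (l - j) := by
      ext x
      rw [add_comm, add_pow, Finset.sum_apply]
      exact sum_congr rfl fun j _ => by simp only [Pi.smul_apply, smul_eq_mul]; ring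
    rw [this, map_sum]
    exact sum_congr rfl fun j _ => by rw [map_smul, smul_eq_mul]; rfl
  rw [bernoulliMoment, bernoulliSum_succ, ← one_sub_succProb]
  have hm : bernoulliMean k (N + 1) = bernoulliMean k N + succProb k N := sum_range_succ _ _
  have e1 : (fun x : ℕ => ((x : ℝ) - bernoulliMean k (N + 1)) ^ l) =
      fun x : ℕ => ((x : ℝ) - bernoulliMean k N + -succProb k N) ^ l := by
    ext x; rw [hm]; ring_nf
  have e2 : (fun x : ℕ => (((x + 1 : ℕ) : ℝ) - bernoulliMean k (N + 1)) ^ l) =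
      fun x : ℕ => ((x : ℝ) - bernoulliMean k N + (1 - succProb k N)) ^ l := by
    ext x; rw [hm]; push_cast; ring_nf
  rw [e1, e2, h, h, ← succProb, mul_sum, mul_sum, ← sum_add_distrib]
  exact sum_congr rfl fun j _ => by rw [stepMoment]; ring

lemma bernoulliMoment_zero_right (k l : ℕ) : bernoulliMoment k l 0 = 0 ^ l := by
  simp [bernoulliMoment, bernoulliSum, bernoulliMean]

lemma bernoulliMoment_zero (k N : ℕ) : bernoulliMoment k 0 N = 1 := by
  induction N with
  | zero => simp [bernoulliMoment_zero_right]
  | succ N ih => simp [bernoulliMoment_succ, ih, stepMoment_zero]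

lemma bernoulliMoment_one (k N : ℕ) : bernoulliMoment k 1 N = 0 := by
  induction N with
  | zero => simp [bernoulliMoment_zero_right]
  | succ N ih => simp [bernoulliMoment_succ, sum_range_succ, ih, stepMoment_one]

lemma bernoulliMoment_succ_sub (k l N : ℕ) :
    bernoulliMoment k (l + 2) (N + 1) - bernoulliMoment k (l + 2) N =
      ∑ i ∈ range (l + 1),
        ((l + 2).choose (i + 2) : ℝ) * stepMoment k (i + 2) N * bernoulliMoment k (l - i) N := by
  rw [bernoulliMoment_succ, sum_range_succ', sum_range_succ', stepMoment_zero, zero_add,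
    stepMoment_one]
  simp only [Nat.choose_zero_right, Nat.sub_zero, add_assoc, Nat.reduceAdd,
    Nat.add_sub_add_right]
  ring

/-- The offset $t$ selects the tail of the increment: $t=0$ takes all of it, $t=1$ leaves out the
leading variance term. -/
lemma abs_sum_stepMoment_le (k N l m t r : ℕ) (B : ℕ → ℝ)
    (hB : ∀ i ≤ m, 0 ≤ B i ∧ |bernoulliMoment k i N| ≤ B i * scaleSq k N ^ (i / 2)) :
    |∑ i ∈ range r, (l.choose (i + t + 2) : ℝ) * stepMoment k (i + t + 2) N *
        bernoulliMoment k (m - i) N| ≤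
      (∑ i ∈ range r, (l.choose (i + t + 2) : ℝ) * B (m - i)) *
        (stepVar k N * scaleSq k N ^ (m / 2)) := by
  rw [sum_mul]
  refine (abs_sum_le_sum_abs _ _).trans (sum_le_sum fun i _ => ?_)
  obtain ⟨h0, h1⟩ := hB (m - i) (Nat.sub_le _ _)
  have h2 : |bernoulliMoment k (m - i) N| ≤ B (m - i) * scaleSq k N ^ (m / 2) :=
    h1.trans (mul_le_mul_of_nonneg_left
      (pow_le_pow_right₀ (one_le_scaleSq k N) (Nat.div_le_div_right (Nat.sub_le _ _))) h0)
  rw [abs_mul, abs_mul, Nat.abs_cast]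
  calc _ ≤ (l.choose (i + t + 2) : ℝ) * stepVar k N * (B (m - i) * scaleSq k N ^ (m / 2)) :=
        mul_le_mul (mul_le_mul_of_nonneg_left (abs_stepMoment_le k _ N) (Nat.cast_nonneg _)) h2
          (abs_nonneg _) (mul_nonneg (Nat.cast_nonneg _) (stepVar_nonneg k N))
    _ = _ := by ring

/-- A discrete integration: $vU^m\le (U+v)^{m+1}-U^{m+1}$, so the increments telescope. -/
lemma abs_le_of_abs_sub_le (k m : ℕ) (a : ℕ → ℝ) (C : ℝ) (hC : 0 ≤ C)
    (h : ∀ N, |a (N + 1) - a N| ≤ C * (stepVar k N * scaleSq k N ^ m)) (N : ℕ) :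
    |a N| ≤ (|a 0| + C) * scaleSq k N ^ (m + 1) := by
  induction N with
  | zero =>
    have : scaleSq k 0 = 1 := by simp [scaleSq]
    simp [this, hC]
  | succ N ih =>
    have hU := one_le_scaleSq k N
    have hv := stepVar_nonneg k N
    have h1 : |a (N + 1)| ≤ |a N| + |a (N + 1) - a N| := by
      simpa using abs_add_le (a N) (a (N + 1) - a N)
    have h2 : scaleSq k N ^ (m + 1) + stepVar k N * scaleSq k N ^ m ≤
        scaleSq k (N + 1) ^ (m + 1) := by
      rw [scaleSq_succ, pow_succ, pow_succ, mul_comm (stepVar k N), ← mul_add]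
      exact mul_le_mul_of_nonneg_right
        (pow_le_pow_left₀ (by linarith) (by linarith) _) (by linarith)
    calc |a (N + 1)| ≤ (|a 0| + C) * scaleSq k N ^ (m + 1) +
          C * (stepVar k N * scaleSq k N ^ m) := by linarith [h N]
      _ ≤ (|a 0| + C) * scaleSq k N ^ (m + 1) +
          (|a 0| + C) * (stepVar k N * scaleSq k N ^ m) := by
        gcongr
        exact le_add_of_nonneg_left (abs_nonneg _)
      _ ≤ _ := by
        rw [← mul_add]
        exact mul_le_mul_of_nonneg_left h2 (by positivity)

lemma exists_abs_bernoulliMoment_le (k : ℕ) : ∃ B : ℕ → ℝ, ∀ l, 0 ≤ B l ∧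
    ∀ N, |bernoulliMoment k l N| ≤ B l * scaleSq k N ^ (l / 2) := by
  suffices h : ∀ l, ∃ C : ℝ, 0 ≤ C ∧ ∀ N, |bernoulliMoment k l N| ≤ C * scaleSq k N ^ (l / 2) by
    choose B hB using h
    exact ⟨B, hB⟩
  intro l
  induction l using Nat.strong_induction_on with
  | _ l ih =>
    match l, ih with
    | 0, _ => exact ⟨1, zero_le_one, fun N => by simp [bernoulliMoment_zero]⟩
    | 1, _ => exact ⟨0, le_rfl, fun N => by simp [bernoulliMoment_one]⟩
    | l + 2, ih =>
      choose! B hB using ih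
      have hB0 : 0 ≤ ∑ i ∈ range (l + 1), ((l + 2).choose (i + 0 + 2) : ℝ) * B (l - i) :=
        sum_nonneg fun i _ => mul_nonneg (Nat.cast_nonneg _) (hB _ (by omega)).1
      refine ⟨_, add_nonneg (abs_nonneg (bernoulliMoment k (l + 2) 0)) hB0, fun N => ?_⟩
      rw [show (l + 2) / 2 = l / 2 + 1 by omega]
      refine abs_le_of_abs_sub_le k (l / 2) (bernoulliMoment k (l + 2)) _ hB0 (fun N => ?_) N
      rw [bernoulliMoment_succ_sub]
      exact abs_sum_stepMoment_le k N (l + 2) l 0 (l + 1) B fun i hi =>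
        ⟨(hB i (by omega)).1, (hB i (by omega)).2 N⟩

/-- A first-order Taylor estimate; the remainder is quadratic in $v$, and $v\le 1$ turns $v^2$ into
$v$, the form needed for summation. -/
lemma exists_abs_add_pow_sub_le (j : ℕ) : ∃ C : ℝ, 0 ≤ C ∧ ∀ u v : ℝ, 1 ≤ u → 0 ≤ v → v ≤ 1 →
    |(u + v) ^ (j + 2) - u ^ (j + 2) - (j + 2) * v * u ^ (j + 1)| ≤ C * (v * u ^ j) := by
  induction j with
  | zero =>
    refine ⟨1, zero_le_one, fun u v hu hv hv1 => ?_⟩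
    rw [show (u + v) ^ (0 + 2) - u ^ (0 + 2) - ((0 : ℕ) + 2) * v * u ^ (0 + 1) = v * v by
      push_cast; ring, abs_of_nonneg (mul_nonneg hv hv)]
    simpa using mul_le_of_le_one_right hv hv1
  | succ j ih =>
    obtain ⟨C, hC, h⟩ := ih
    refine ⟨j + 2 + 2 * C, by positivity, fun u v hu hv hv1 => ?_⟩
    set e := (u + v) ^ (j + 2) - u ^ (j + 2) - (j + 2) * v * u ^ (j + 1) with he
    have h1 : (u + v) ^ (j + 1 + 2) - u ^ (j + 1 + 2) - ((j + 1 : ℕ) + 2) * v * u ^ (j + 1 + 1) =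
        (j + 2) * (v * v * u ^ (j + 1)) + (u + v) * e := by
      rw [he]; push_cast; ring
    have h2 : |(u + v) * e| ≤ (2 * u) * (C * (v * u ^ j)) := by
      rw [abs_mul, abs_of_nonneg (by linarith : 0 ≤ u + v)]
      exact mul_le_mul (by linarith) (h u v hu hv hv1) (abs_nonneg _) (by linarith)
    have hu' : 0 ≤ u ^ (j + 1) := by positivity
    have h3 : v * v * u ^ (j + 1) ≤ v * u ^ (j + 1) :=
      mul_le_mul_of_nonneg_right (mul_le_of_le_one_right hv hv1) hu'
    rw [h1]
    calc _ ≤ |((j : ℝ) + 2) * (v * v * u ^ (j + 1))| + |(u + v) * e| := abs_add_le _ _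
      _ ≤ ((j : ℝ) + 2) * (v * u ^ (j + 1)) + (2 * u) * (C * (v * u ^ j)) := by
        rw [abs_of_nonneg (by positivity)]
        gcongr
      _ = _ := by ring

lemma bernoulliMoment_two (k N : ℕ) : bernoulliMoment k 2 N = scaleSq k N - 1 := by
  induction N with
  | zero => simp [bernoulliMoment_zero_right, scaleSq]
  | succ N ih =>
    have := bernoulliMoment_succ_sub k 0 N
    simp only [zero_add, sum_range_one, Nat.choose_self, stepMoment_two, Nat.sub_zero,
      bernoulliMoment_zero] at this
    rw [scaleSq_succ]
    push_cast at this
    linarith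

lemma exists_abs_bernoulliMoment_even_sub_le (k j : ℕ) : ∃ C : ℝ, 0 ≤ C ∧ ∀ N,
    |bernoulliMoment k (2 * j + 2) N -
      (Nat.doubleFactorial (2 * j + 1) : ℝ) * scaleSq k N ^ (j + 1)| ≤ C * scaleSq k N ^ j := by
  induction j with
  | zero => exact ⟨1, zero_le_one, fun N => by simp [bernoulliMoment_two]⟩
  | succ j ih =>
    obtain ⟨C, hC, h⟩ := ih
    obtain ⟨B, hB⟩ := exists_abs_bernoulliMoment_le k
    obtain ⟨E, hE, hE'⟩ := exists_abs_add_pow_sub_le j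
    have hdf : (Nat.doubleFactorial (2 * (j + 1) + 1) : ℝ) =
        (2 * j + 3) * Nat.doubleFactorial (2 * j + 1) := by
      rw [show 2 * (j + 1) + 1 = (2 * j + 1) + 2 by ring, Nat.doubleFactorial_add_two]
      push_cast
      ring
    have hch : (((2 * j + 2 + 2).choose 2 : ℕ) : ℝ) = (j + 2) * (2 * j + 3) := by
      rw [Nat.cast_choose_two]
      push_cast
      ring
    set S : ℝ := ∑ i ∈ range (2 * j + 2), ((2 * j + 2 + 2).choose (i + 1 + 2) : ℝ) *
      B (2 * j + 1 - i) with hS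
    have hS0 : 0 ≤ S := sum_nonneg fun i _ => mul_nonneg (Nat.cast_nonneg _) (hB _).1
    set g : ℝ := (Nat.doubleFactorial (2 * j + 1) : ℝ) with hg
    have hg0 : 0 ≤ g := Nat.cast_nonneg _
    have hD : 0 ≤ (j + 2) * (2 * j + 3) * C + S + (2 * j + 3) * g * E := by positivity
    set a : ℕ → ℝ := fun N => bernoulliMoment k (2 * (j + 1) + 2) N -
      (Nat.doubleFactorial (2 * (j + 1) + 1) : ℝ) * scaleSq k N ^ (j + 1 + 1) with ha
    refine ⟨_, add_nonneg (abs_nonneg (a 0)) hD, fun N => ?_⟩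
    refine abs_le_of_abs_sub_le k j a _ hD (fun N => ?_) N
    simp only [ha]
    have hU := one_le_scaleSq k N
    have hv := stepVar_nonneg k N
    have h1 := bernoulliMoment_succ_sub k (2 * j + 2) N
    rw [sum_range_succ'] at h1
    simp only [zero_add, Nat.sub_zero, stepMoment_two, hch, Nat.reduceSubDiff] at h1
    have h2 := abs_sum_stepMoment_le k N (2 * j + 2 + 2) (2 * j + 1) 1 (2 * j + 2) B
      fun i _ => ⟨(hB i).1, (hB i).2 N⟩
    rw [← hS, show (2 * j + 1) / 2 = j by omega] at h2
    set R := ∑ i ∈ range (2 * j + 2), ((2 * j + 2 + 2).choose (i + 1 + 2) : ℝ) *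
      stepMoment k (i + 1 + 2) N * bernoulliMoment k (2 * j + 1 - i) N with hR
    have h3 := hE' (scaleSq k N) (stepVar k N) hU hv (stepVar_le_one k N)
    have h4 := h N
    rw [hdf, scaleSq_succ]
    set U := scaleSq k N
    set v := stepVar k N
    set e := (U + v) ^ (j + 2) - U ^ (j + 2) - (j + 2) * v * U ^ (j + 1) with he
    set d := bernoulliMoment k (2 * j + 2) N - g * U ^ (j + 1) with hd
    -- The main terms cancel because $\binom{2j+4}{2}(2j+1)!!=(j+2)(2j+3)!!$, which matches the
    -- linear term of $(2j+3)!!\,(U+v)^{j+2}$.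
    have key : bernoulliMoment k (2 * (j + 1) + 2) (N + 1) - (2 * j + 3) * g * (U + v) ^ (j + 1 + 1) -
        (bernoulliMoment k (2 * (j + 1) + 2) N - (2 * j + 3) * g * U ^ (j + 1 + 1)) =
        (j + 2) * (2 * j + 3) * v * d + R - (2 * j + 3) * g * e := by
      rw [show 2 * (j + 1) + 2 = 2 * j + 2 + 2 by ring, hd, he]
      linear_combination h1
    rw [key]
    calc _ ≤ |((j : ℝ) + 2) * (2 * j + 3) * v * d| + |R| + |(2 * (j : ℝ) + 3) * g * e| :=
          (abs_sub _ _).trans (add_le_add_left (abs_add_le _ _) _)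
      _ ≤ ((j : ℝ) + 2) * (2 * j + 3) * v * (C * U ^ j) + S * (v * U ^ j) +
          (2 * (j : ℝ) + 3) * g * (E * (v * U ^ j)) := by
        rw [abs_mul, abs_mul (_ * g), abs_of_nonneg (by positivity : 0 ≤ ((j : ℝ) + 2) * (2 * j + 3) * v),
          abs_of_nonneg (by positivity : 0 ≤ (2 * (j : ℝ) + 3) * g)]
        gcongr
      _ = _ := by ring

/-- The moments of the standard normal distribution. -/
noncomputable def normalMoment (l : ℕ) : ℝ :=
  if Even l then (Nat.doubleFactorial (l - 1) : ℝ) else 0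

lemma exists_abs_bernoulliMoment_sub_normalMoment_le (k l : ℕ) (hl : 1 ≤ l) : ∃ C : ℝ, ∀ N,
    |bernoulliMoment k l N - normalMoment l * √(scaleSq k N) ^ l| ≤
      C * √(scaleSq k N) ^ (l - 1) := by
  have hs : ∀ N j, √(scaleSq k N) ^ (2 * j) = scaleSq k N ^ j := fun N j => by
    rw [pow_mul, Real.sq_sqrt (zero_le_one.trans (one_le_scaleSq k N))]
  have hs1 : ∀ N, 1 ≤ √(scaleSq k N) := fun N => Real.one_le_sqrt.2 (one_le_scaleSq k N)
  obtain ⟨j, rfl | rfl⟩ := Nat.even_or_odd' l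
  · obtain ⟨j, rfl⟩ : ∃ i, j = i + 1 := ⟨j - 1, by omega⟩
    obtain ⟨C, hC, h⟩ := exists_abs_bernoulliMoment_even_sub_le k j
    refine ⟨C, fun N => ?_⟩
    rw [normalMoment, if_pos (even_two_mul _), hs]
    refine (h N).trans ?_
    rw [← hs]
    exact mul_le_mul_of_nonneg_left (pow_le_pow_right₀ (hs1 N) (by omega)) hC
  · obtain ⟨B, hB⟩ := exists_abs_bernoulliMoment_le k
    refine ⟨B (2 * j + 1), fun N => ?_⟩
    rw [normalMoment, if_neg (by simp), zero_mul, sub_zero, Nat.add_sub_cancel, hs]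
    simpa [show (2 * j + 1) / 2 = j by omega] using (hB (2 * j + 1)).2 N

/-- Since $m+1+k\le(1+k)(m+1)$, each step variance is at least $\frac{k}{(1+k)^2}\cdot\frac1{m+1}$.
-/
lemma tendsto_scaleSq (k : ℕ) (hk : 1 ≤ k) :
    Filter.Tendsto (scaleSq k) Filter.atTop Filter.atTop := by
  have hk' : (1 : ℝ) ≤ k := by exact_mod_cast hk
  have hc : (0 : ℝ) < k / (1 + k) ^ 2 := by positivity
  refine Filter.tendsto_atTop_mono (fun N => ?_)
    (Real.tendsto_sum_range_one_div_nat_succ_atTop.const_mul_atTop hc)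
  rw [mul_sum]
  refine (sum_le_sum fun m _ => ?_).trans (le_add_of_nonneg_left zero_le_one)
  rw [stepVar, one_sub_succProb, succProb, div_mul_div_comm, div_mul_div_comm,
    div_le_div_iff₀ (by positivity) (by positivity)]
  have hm : (0 : ℝ) ≤ m := Nat.cast_nonneg _
  have h : (m + 1 + k : ℝ) ≤ (1 + k) * (m + 1) := by nlinarith
  calc (k : ℝ) * 1 * ((m + 1 + k) * (m + 1 + k))
      ≤ k * 1 * (((1 + k) * (m + 1)) * ((1 + k) * (m + 1))) := by gcongr
    _ = _ := by ring

end BernoulliSum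

/-! ### Stability of moments under bounded perturbations -/

section Perturbation

variable {α : Type*} [Fintype α]

/-- Odd absolute moments are controlled by even moments through $y\le y^2/t+t$ with $y=|Y|^i$,
$t=s^i$. -/
lemma expect_abs_pow_le (p : PMF α) (Y : α → ℝ) (i : ℕ) (s B : ℝ) (hs : 0 < s)
    (hY : expect p (fun a => Y a ^ (2 * i)) ≤ B * s ^ (2 * i)) :
    expect p (fun a => |Y a| ^ i) ≤ (B + 1) * s ^ i := by
  have hsi : 0 < s ^ i := pow_pos hs i
  calc expect p (fun a => |Y a| ^ i) ≤ expect p fun a => (s ^ i)⁻¹ * Y a ^ (2 * i) + s ^ i := by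
        refine expect_mono p fun a => ?_
        have : Y a ^ (2 * i) = (|Y a| ^ i) ^ 2 := by rw [← pow_mul, mul_comm i, pow_mul, pow_mul,
          sq_abs]
        rw [this, ← sub_nonneg]
        have e : (s ^ i)⁻¹ * (|Y a| ^ i) ^ 2 + s ^ i - |Y a| ^ i =
          (s ^ i)⁻¹ * ((|Y a| ^ i) ^ 2 + (s ^ i) ^ 2 - |Y a| ^ i * s ^ i) := by field_simp
        rw [e]
        refine mul_nonneg (by positivity) ?_
        nlinarith [sq_nonneg (|Y a| ^ i - s ^ i), sq_nonneg (|Y a| ^ i), sq_nonneg (s ^ i)]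
    _ = (s ^ i)⁻¹ * expect p (fun a => Y a ^ (2 * i)) + s ^ i := by
      rw [expect_add, expect_const_mul, expect_const]
    _ ≤ (s ^ i)⁻¹ * (B * s ^ (2 * i)) + s ^ i := by gcongr
    _ = _ := by
      rw [mul_comm 2 i, pow_mul]
      field_simp

lemma abs_expect_add_pow_sub_le (p : PMF α) (Y e : α → ℝ) (l : ℕ) (s c : ℝ) (A : ℕ → ℝ)
    (hs : 1 ≤ s) (hc : 0 ≤ c) (he : ∀ a, |e a| ≤ c) (hA : ∀ i, 0 ≤ A i)
    (hY : ∀ i, expect p (fun a => |Y a| ^ i) ≤ A i * s ^ i) :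
    |expect p (fun a => (Y a + e a) ^ l) - expect p (fun a => Y a ^ l)| ≤
      (∑ i ∈ range l, (l.choose i : ℝ) * c ^ (l - i) * A i) * s ^ (l - 1) := by
  rw [← expect_sub]
  calc _ ≤ expect p fun a => ∑ i ∈ range l, ((l.choose i : ℝ) * c ^ (l - i)) * |Y a| ^ i := by
        refine (abs_expect_le _ _).trans (expect_mono p fun a => ?_)
        rw [add_pow, sum_range_succ]
        simp only [Nat.sub_self, pow_zero, mul_one, Nat.choose_self, Nat.cast_one,
          add_sub_cancel_right]
        refine (abs_sum_le_sum_abs _ _).trans (sum_le_sum fun i _ => ?_)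
        rw [abs_mul, abs_mul, abs_pow, abs_pow, Nat.abs_cast]
        calc _ ≤ |Y a| ^ i * c ^ (l - i) * (l.choose i : ℝ) := by
              gcongr
              exact he a
          _ = _ := by ring
    _ = ∑ i ∈ range l, ((l.choose i : ℝ) * c ^ (l - i)) * expect p (fun a => |Y a| ^ i) := by
      rw [expect_sum]
      exact sum_congr rfl fun i _ => expect_const_mul _ _ _
    _ ≤ _ := by
      rw [sum_mul]
      refine sum_le_sum fun i hi => ?_
      rw [mul_assoc (_ * _)]
      refine mul_le_mul_of_nonneg_left ((hY i).trans ?_) (by positivity)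
      have := mem_range.1 hi
      exact mul_le_mul_of_nonneg_left (pow_le_pow_right₀ hs (by omega)) (hA i)

end Perturbation

/-! ### Asymptotics of the central moments of $X_n$ -/

lemma exists_abs_centralMoment_sub_le (k l : ℕ) (hl : 1 ≤ l) : ∃ C : ℝ, ∀ N,
    |centralMoment l (N + k) k - normalMoment l * √(scaleSq k N) ^ l| ≤
      C * √(scaleSq k N) ^ (l - 1) := by
  obtain ⟨C, hC⟩ := exists_abs_bernoulliMoment_sub_normalMoment_le k l hl
  obtain ⟨B, hB⟩ := exists_abs_bernoulliMoment_le k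
  refine ⟨(∑ i ∈ range l, (l.choose i : ℝ) * (k : ℝ) ^ (l - i) * (B (2 * i) + 1)) + C,
    fun N => ?_⟩
  have hU := one_le_scaleSq k N
  set s := √(scaleSq k N) with hs
  have hs1 : 1 ≤ s := Real.one_le_sqrt.2 hU
  set p := seatingLaw (N + k) k with hp
  set D : (Fin (N + k) → Fin (N + k)) → ℝ := fun σ => lateWrong k (List.finRange (N + k)) σ
  set W : (Fin (N + k) → Fin (N + k)) → ℝ := fun σ => wrongSeats σ with hW
  set m := expect p W with hm
  have hmom : ∀ i, expect p (fun σ => (D σ - bernoulliMean k N) ^ i) = bernoulliMoment k i N := by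
    intro i
    have := expect_seatingLaw_lateWrong (n := N + k) k
      (fun x => ((x : ℝ) - bernoulliMean k N) ^ i) (by omega)
    rwa [Nat.add_sub_cancel] at this
  have hWD : ∀ σ, 0 ≤ W σ - D σ ∧ W σ - D σ ≤ k := by
    intro σ
    obtain ⟨h1, h2⟩ := lateWrong_le_wrongSeats k σ
    have h1' : D σ ≤ W σ := Nat.cast_le.2 h1
    have h2' : W σ ≤ D σ + k := (Nat.cast_le.2 h2).trans_eq (Nat.cast_add _ _)
    constructor <;> linarith
  have hmean : m - bernoulliMean k N = expect p fun σ => W σ - D σ := by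
    have h1 := hmom 1
    simp only [pow_one, bernoulliMoment_one] at h1
    rw [expect_sub, expect_const] at h1
    rw [expect_sub]
    linarith
  have hmean0 : 0 ≤ m - bernoulliMean k N := by
    rw [hmean, ← expect_const p 0]
    exact expect_mono p fun σ => (hWD σ).1
  have hmeank : m - bernoulliMean k N ≤ k := by
    rw [hmean, ← expect_const p (k : ℝ)]
    exact expect_mono p fun σ => (hWD σ).2
  have hA : ∀ i, expect p (fun σ => |D σ - bernoulliMean k N| ^ i) ≤ (B (2 * i) + 1) * s ^ i := by
    intro i
    refine expect_abs_pow_le p _ i s _ (zero_lt_one.trans_le hs1) ?_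
    rw [hmom, pow_mul, hs, Real.sq_sqrt (by linarith)]
    have := (le_abs_self _).trans ((hB (2 * i)).2 N)
    rwa [Nat.mul_div_cancel_left i two_pos] at this
  -- The perturbation is $W-D$ minus its mean; both lie in $[0,k]$, so it is at most $k$ in absolute
  -- value.
  have h1 := abs_expect_add_pow_sub_le p (fun σ => D σ - bernoulliMean k N)
    (fun σ => (W σ - D σ) - (m - bernoulliMean k N)) l s k (fun i => B (2 * i) + 1) hs1
    (Nat.cast_nonneg k)
    (fun σ => abs_le.2 ⟨by linarith [(hWD σ).1], by linarith [(hWD σ).2]⟩)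
    (fun i => add_nonneg (hB _).1 zero_le_one) hA
  rw [hmom] at h1
  have h2 : centralMoment l (N + k) k = expect p fun σ =>
      (D σ - bernoulliMean k N + ((W σ - D σ) - (m - bernoulliMean k N))) ^ l := by
    rw [centralMoment_eq]
    congr 1
    ext σ
    rw [hm, hW]
    ring
  rw [h2, add_mul]
  exact (abs_sub_le _ _ _).trans (add_le_add h1 (hC N))

lemma tendsto_centralMoment_div (k l : ℕ) (hk : 1 ≤ k) (hl : 1 ≤ l) :
    Filter.Tendsto (fun N => centralMoment l (N + k) k / √(scaleSq k N) ^ l) Filter.atTop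
      (nhds (normalMoment l)) := by
  obtain ⟨C, hC⟩ := exists_abs_centralMoment_sub_le k l hl
  have hs : Filter.Tendsto (fun N => √(scaleSq k N)) Filter.atTop Filter.atTop :=
    Real.tendsto_sqrt_atTop.comp (tendsto_scaleSq k hk)
  rw [tendsto_iff_dist_tendsto_zero]
  refine squeeze_zero (fun _ => dist_nonneg) (fun N => ?_) (hs.const_div_atTop C)
  have hpos : 0 < √(scaleSq k N) :=
    zero_lt_one.trans_le (Real.one_le_sqrt.2 (one_le_scaleSq k N))
  have h := hC N
  set s := √(scaleSq k N)
  have e : centralMoment l (N + k) k / s ^ l - normalMoment l =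
      (centralMoment l (N + k) k - normalMoment l * s ^ l) / s ^ l := by field_simp
  rw [Real.dist_eq, e, abs_div, abs_of_pos (pow_pos hpos l), div_le_div_iff₀ (pow_pos hpos l) hpos]
  calc _ ≤ C * s ^ (l - 1) * s := mul_le_mul_of_nonneg_right h hpos.le
    _ = C * s ^ l := by rw [mul_assoc, ← pow_succ, Nat.sub_add_cancel hl]

lemma tendsto_normalized_centralMoment (k l : ℕ) (hk : 1 ≤ k) (hl : 1 ≤ l) :
    Filter.Tendsto (fun n => centralMoment l n k / centralMoment 2 n k ^ ((l : ℝ) / 2))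
      Filter.atTop (nhds (normalMoment l)) := by
  rw [← Filter.tendsto_add_atTop_iff_nat k]
  have h2 := tendsto_centralMoment_div k 2 hk one_le_two
  have hn : normalMoment 2 = 1 := by simp [normalMoment]
  rw [hn] at h2
  have h3 := (tendsto_centralMoment_div k l hk hl).div
    (h2.rpow_const (p := (l : ℝ) / 2) (Or.inl one_ne_zero)) (by simp)
  rw [Real.one_rpow, div_one] at h3
  refine h3.congr fun N => ?_
  have hpos : 0 < √(scaleSq k N) :=
    zero_lt_one.trans_le (Real.one_le_sqrt.2 (one_le_scaleSq k N))
  have hm : 0 ≤ centralMoment 2 (N + k) k := by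
    rw [centralMoment_eq, ← expect_const (seatingLaw (N + k) k) 0]
    exact expect_mono _ fun σ => sq_nonneg _
  set s := √(scaleSq k N)
  have hsl : (s ^ 2) ^ ((l : ℝ) / 2) = s ^ l := by
    rw [← Real.rpow_natCast s 2, ← Real.rpow_mul hpos.le, ← Real.rpow_natCast s l]
    congr 1
    push_cast
    ring
  rw [Pi.div_apply, Real.div_rpow hm (by positivity), hsl,
    div_div_div_cancel_right₀ (pow_pos hpos l).ne']

end AbsentMinded

/-! ### Moments of the standard normal law -/

namespace AbsentMinded

open MeasureTheory ProbabilityTheory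

lemma integrable_pow_gaussianReal (l : ℕ) :
    Integrable (fun x : ℝ => x ^ l) (gaussianReal 0 1) := by
  have h := (memLp_id_gaussianReal (μ := 0) (v := 1) (l : NNReal)).integrable_norm_pow'
  refine (integrable_norm_iff (by fun_prop)).1 ?_
  simpa [norm_pow] using h

lemma integral_pow_gaussianReal_of_odd (l : ℕ) (hl : Odd l) :
    ∫ x : ℝ, x ^ l ∂(gaussianReal 0 1) = 0 := by
  have h : ∫ x : ℝ, x ^ l ∂((gaussianReal 0 1).map fun x => -x) =
      ∫ x : ℝ, (-x) ^ l ∂(gaussianReal 0 1) :=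
    integral_map (by fun_prop) (by fun_prop)
  rw [gaussianReal_map_neg, neg_zero] at h
  simp only [hl.neg_pow, integral_neg] at h
  linarith

lemma integral_pow_gaussianReal_of_even (j : ℕ) :
    ∫ x : ℝ, x ^ (2 * j) ∂(gaussianReal 0 1) = (Nat.doubleFactorial (2 * j - 1) : ℝ) := by
  rw [integral_gaussianReal_eq_integral_smul one_ne_zero]
  -- Writing the integrand as a function of $|x|$ reduces the integral to the half-line, where it is
  -- a value of $\Gamma(j+\tfrac12)$.
  have h1 : ∀ x : ℝ, gaussianPDFReal 0 1 x • x ^ (2 * j) =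
      (fun y : ℝ => (√(2 * Real.pi))⁻¹ * (y ^ ((2 * j : ℕ) : ℝ) * Real.exp (-(1 / 2) * y ^ (2 : ℝ))))
        |x| := by
    intro x
    have : |x| ^ (2 * j) = x ^ (2 * j) := by rw [pow_mul, sq_abs, pow_mul]
    simp only [gaussianPDFReal, smul_eq_mul, Real.rpow_natCast, this, Real.rpow_two, sq_abs]
    simp only [NNReal.coe_one, mul_one, sub_zero]
    ring_nf
  simp_rw [h1]
  rw [integral_comp_abs (f := fun y : ℝ =>
      (√(2 * Real.pi))⁻¹ * (y ^ ((2 * j : ℕ) : ℝ) * Real.exp (-(1 / 2) * y ^ (2 : ℝ)))),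
    integral_const_mul, integral_rpow_mul_exp_neg_mul_rpow two_pos
      (lt_of_lt_of_le neg_one_lt_zero (Nat.cast_nonneg _)) (by norm_num)]
  have h2 : (((2 * j : ℕ) : ℝ) + 1) / 2 = j + 1 / 2 := by push_cast; ring
  rw [neg_div, h2, Real.Gamma_nat_add_half, one_div, Real.inv_rpow two_pos.le,
    ← Real.rpow_neg two_pos.le, neg_neg, Real.rpow_add two_pos, Real.rpow_natCast,
    ← one_div (2 : ℝ), ← Real.sqrt_eq_rpow, Real.sqrt_mul two_pos.le]
  field_simp

end AbsentMinded

theorem mainTheorem4 (k : ℕ) (hk : 1 ≤ k) :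
    (∀ l : ℕ, Odd l → l ≤ 17 →
      Filter.Tendsto
        (fun n : ℕ => AbsentMinded.centralMoment l n k /
          (AbsentMinded.centralMoment 2 n k) ^ ((l : ℝ) / 2))
        Filter.atTop (nhds 0) ∧
      MeasureTheory.Integrable (fun x : ℝ => x ^ l) (ProbabilityTheory.gaussianReal 0 1) ∧
      ∫ x : ℝ, x ^ l ∂(ProbabilityTheory.gaussianReal 0 1) = 0) ∧
    (∀ j : ℕ, 1 ≤ j → 2 * j ≤ 18 →
      Filter.Tendsto
        (fun n : ℕ => AbsentMinded.centralMoment (2 * j) n k /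
          (AbsentMinded.centralMoment 2 n k) ^ (((2 * j : ℕ) : ℝ) / 2))
        Filter.atTop (nhds (Nat.doubleFactorial (2 * j - 1) : ℝ)) ∧
      MeasureTheory.Integrable (fun x : ℝ => x ^ (2 * j)) (ProbabilityTheory.gaussianReal 0 1) ∧
      ∫ x : ℝ, x ^ (2 * j) ∂(ProbabilityTheory.gaussianReal 0 1) =
        (Nat.doubleFactorial (2 * j - 1) : ℝ)) := by
  refine ⟨fun l hl _ => ⟨?_, AbsentMinded.integrable_pow_gaussianReal l,
    AbsentMinded.integral_pow_gaussianReal_of_odd l hl⟩, fun j hj _ => ⟨?_,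
    AbsentMinded.integrable_pow_gaussianReal _,
    AbsentMinded.integral_pow_gaussianReal_of_even j⟩⟩
  · simpa [AbsentMinded.normalMoment, Nat.not_even_iff_odd.2 hl] using
      AbsentMinded.tendsto_normalized_centralMoment k l hk hl.pos
  · have h := AbsentMinded.tendsto_normalized_centralMoment k (2 * j) hk (by omega)
    rwa [AbsentMinded.normalMoment, if_pos (even_two_mul j)] at h
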